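/- Let $\mathfrak S_n$ be the set of permutations $\pi=\pi(1)\cdots\pi(n)$ of $\{1,\dots,n\}$, and put $\pi(0)=0$. - $P(n,k)$ is the number of $\pi\in\mathfrak S_n$ with exactly $k$ left peaks, that is, indices $i\in\{1,\dots,n-1\}$ with $\pi(i-1)<\pi(i)>\pi(i+1)$. - A word $w_1\cdots w_m$ of distinct numbers changes direction at an inner position $i$ ($1<i<m$) if $w_{i-1}<w_i>w_{i+1}$ or $w_{i-1}>w_i<w_{i+1}$. If $m\ge 2$, its number of alternating runs is one more than the number of positions at which it changes direction; a word with one letter has $0$ alternating runs. $R(n,k)$ is the number of $\pi\in\mathfrak S_n$ whose word $\pi(1)\cdots\pi(n)$ has $k$ alternating runs, and $M(n,k)$ is the number of $\pi\in\mathfrak S_n$ with $k$ up-down runs, i.e. for which the word $0\,\pi(1)\cdots\pi(n)$ has $k$ alternating runs. - A signed permutation is a permutation $\pi$ of $\{\pm1,\dots,\pm n\}$ with $\pi(-i)=-\pi(i)$ for all $i$. A run of it is a maximal interval of consecutive entries of the word $0\,\pi(1)\cdots\pi(n)$ on which the entries are monotonic. $T(n,k)$ is the number of signed permutations of $\{\pm1,\dots,\pm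 n\}$ with $\pi(1)>0$ and with exactly $k$ runs. **Theorem.** Let $D$ be the formal derivative of the grammar $G=\{x\mapsto xy^2,\ y\mapsto yz^2,\ z\mapsto y^4z^{-1}\}$, i.e. the derivation $$D=xy^2\frac{\partial}{\partial x}+yz^2\frac{\partial}{\partial y}+y^4z^{-1}\frac{\partial}{\partial z}$$ on the ring of formal power series with rational coefficients in the letters $x,y,z$, in which the letters are made invertible. Then for all $n\ge 1$, $$\begin{aligned} D^n(x^3y)&=x^3y\sum_{k=1}^{n+1}T(n+1,k)\,y^{2k-2}z^{2n-2k+2},\\ D^n(xy)&=xy(y^2+z^2)\sum_{k=1}^{n}T(n,k)\,y^{2k-2}z^{2n-2k},\\ D^n(x^2)&=2^nx^2\sum_{k=0}^{n}M(n,k)\,y^{2k}z^{2n-2k},\\ D^n(x^2y^2)&=2^{n-1}x^2(y^2+z^2)\sum_{k=1}^{n}R(n+1,k)\,y^{2k}z^{2n-2k},\\ D^n(y^2)&=2^{n}y^2\sum_{k=0}^{\lfloor n/2\rfloor}P(n,k)\,y^{4k}z^{2n-4k}. \end{aligned}$$ -/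

import Mathlib

/-! ### Formal derivatives of context-free grammars -/

/-- Formal power series with rational coefficients in the letters of a finite alphabet `A`,
finitely many of whose (integer) exponents may be negative: the supports are the well partially
ordered subsets of `ℤ^A`.  It contains `ℚ[[A]]`, and every letter is invertible in it. -/
abbrev FormalSeries (A : Type) : Type := HahnSeries (A → ℤ) ℚ

/-- The letter `a`, as a formal series. -/
noncomputable def letter {A : Type} [DecidableEq A] (a : A) : FormalSeries A :=
  HahnSeries.single (Pi.single a 1) 1

/-- The formal series `a⁻¹`. -/
noncomputable def letterInv {A : Type} [DecidableEq A] (a : A) : FormalSeries A :=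
  HahnSeries.single (Pi.single a (-1)) 1

theorem letter_mul_letterInv {A : Type} [DecidableEq A] (a : A) :
    letter a * letterInv a = 1 := by
  rw [letter, letterInv, HahnSeries.single_mul_single, ← Pi.single_add]
  simp

/-- The Euler operator `a ∂/∂a`: it multiplies each monomial by its exponent in `a`. -/
def eulerOp {A : Type} (a : A) : FormalSeries A →ₗ[ℚ] FormalSeries A where
  toFun f :=
    { coeff := fun e => (e a : ℚ) * f.coeff e
      isPWO_support' := f.isPWO_support.mono (fun e he hf => he (by simp [hf])) }
  map_add' f g := by
    ext e
    simp [mul_add]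
  map_smul' c f := by
    ext e
    simp [mul_left_comm]

theorem eulerOp_coeff {A : Type} (a : A) (f : FormalSeries A) (e : A → ℤ) :
    (eulerOp a f).coeff e = (e a : ℚ) * f.coeff e := rfl

theorem eulerOp_mul {A : Type} (a : A) (f g : FormalSeries A) :
    eulerOp a (f * g) = f * eulerOp a g + g * eulerOp a f := by
  have hsub : ∀ h : FormalSeries A, (eulerOp a h).support ⊆ h.support := by
    intro h e he hf
    exact he (by simp [eulerOp_coeff, hf])
  rw [mul_comm g]
  ext e
  rw [HahnSeries.coeff_add, eulerOp_coeff, HahnSeries.coeff_mul,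
    HahnSeries.coeff_mul_right' g.isPWO_support (hsub g),
    HahnSeries.coeff_mul_left' f.isPWO_support (hsub f), Finset.mul_sum,
    ← Finset.sum_add_distrib]
  refine Finset.sum_congr rfl fun p hp => ?_
  have h : p.1 + p.2 = e := (Finset.mem_antidiagonal.1 hp).2.2
  rw [eulerOp_coeff, eulerOp_coeff, ← h]
  simp only [Pi.add_apply]
  push_cast
  ring

/-- The formal derivative `D_G = ∑ a, G(a) ∂/∂a` of a context-free grammar `G`. -/
noncomputable def formalDerivative {A : Type} [Fintype A] [DecidableEq A]
    (G : A → FormalSeries A) : Derivation ℚ (FormalSeries A) (FormalSeries A) :=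
  Derivation.mk'
    (∑ a, (LinearMap.mulLeft ℚ (G a * letterInv a)).comp (eulerOp a))
    (fun f g => by
      simp only [LinearMap.sum_apply, LinearMap.comp_apply, LinearMap.mulLeft_apply,
        eulerOp_mul, smul_eq_mul, Finset.mul_sum, ← Finset.sum_add_distrib]
      exact Finset.sum_congr rfl fun a _ => by ring)

theorem formalDerivative_letter {A : Type} [Fintype A] [DecidableEq A]
    (G : A → FormalSeries A) (a : A) : formalDerivative G (letter a) = G a := by
  have h : ∀ b, eulerOp b (letter a) = if b = a then letter a else 0 := by
    intro b
    ext e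
    rw [eulerOp_coeff]
    by_cases hb : b = a
    · subst hb
      by_cases he : e = Pi.single b 1
      · subst he
        simp
      · simp [letter, HahnSeries.coeff_single_of_ne he]
    · by_cases he : e = Pi.single a 1
      · subst he
        simp [hb]
      · simp [hb, letter, HahnSeries.coeff_single_of_ne he]
  change (∑ b, (LinearMap.mulLeft ℚ (G b * letterInv b)).comp (eulerOp b)) (letter a) = G a
  simp only [LinearMap.sum_apply, LinearMap.comp_apply, LinearMap.mulLeft_apply, h]
  simp only [mul_ite, mul_zero, Finset.sum_ite_eq', Finset.mem_univ, if_true]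
  rw [mul_assoc, mul_comm (letterInv a), letter_mul_letterInv, mul_one]

/-! ### Statistics on permutations -/

/-- One-line notation of a permutation of `{1, …, n}`: `π(1), …, π(n)` at the positions
`1, …, n`, and `π(0) = 0`. (The entry at a position beyond `n` is irrelevant.) -/
def permWord {n : ℕ} (π : Equiv.Perm (Fin n)) (i : ℕ) : ℤ :=
  if h : 1 ≤ i ∧ i ≤ n then ((π ⟨i - 1, by omega⟩ : ℕ) : ℤ) + 1 else 0

/-- The number of left peaks of `π`. -/
def leftPeaks {n : ℕ} (π : Equiv.Perm (Fin n)) : ℕ :=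
  ((Finset.Ico 1 n).filter fun i =>
    permWord π (i - 1) < permWord π i ∧ permWord π (i + 1) < permWord π i).card

/-- The number of alternating runs of the word `w(p) w(p+1) ⋯ w(q)`: one more than the number
of inner positions at which it changes direction, and `0` for a word with one letter. -/
def altRuns (w : ℕ → ℤ) (p q : ℕ) : ℕ :=
  if p < q then
    ((Finset.Ioo p q).filter fun i =>
      (w (i - 1) < w i ∧ w (i + 1) < w i) ∨ (w i < w (i - 1) ∧ w i < w (i + 1))).card + 1
  else 0

/-- `P(n,k)`: permutations of `{1, …, n}` with `k` left peaks. -/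
def numP (n k : ℕ) : ℕ :=
  (Finset.univ.filter fun π : Equiv.Perm (Fin n) => leftPeaks π = k).card

/-- `R(n,k)`: permutations of `{1, …, n}` with `k` alternating runs. -/
def numR (n k : ℕ) : ℕ :=
  (Finset.univ.filter fun π : Equiv.Perm (Fin n) => altRuns (permWord π) 1 n = k).card

/-- `M(n,k)`: permutations of `{1, …, n}` with `k` up-down runs, that is, alternating runs of
the word with a `0` in front. -/
def numM (n k : ℕ) : ℕ :=
  (Finset.univ.filter fun π : Equiv.Perm (Fin n) => altRuns (permWord π) 0 n = k).card

/-! ### Statistics on signed permutations -/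

/-- The set `{±1, …, ±n}`. -/
noncomputable def pmSet (n : ℕ) : Finset ℤ := (Finset.Icc (-(n : ℤ)) n).erase 0

/-- The signed permutations of `{±1, …, ±n}`: those `π` with `π(-i) = -π(i)`. -/
abbrev SignedPerm (n : ℕ) : Type :=
  {π : Equiv.Perm (pmSet n) // ∀ i j : pmSet n, (j : ℤ) = -i → (π j : ℤ) = -(π i : ℤ)}

/-- The word `π(0) π(1) ⋯ π(n)` of a signed permutation, with `π(0) = 0`.
(The entry at a position beyond `n` is irrelevant.) -/
noncomputable def signedWord {n : ℕ} (π : SignedPerm n) (i : ℕ) : ℤ :=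
  if h : (i : ℤ) ∈ pmSet n then (π.1 ⟨i, h⟩ : ℤ) else 0

/-- The word `w` is monotonic on the positions `a, a + 1, …, b`. -/
def MonoOnInterval (w : ℕ → ℤ) (a b : ℕ) : Prop :=
  (∀ i ∈ Finset.Ico a b, w i < w (i + 1)) ∨ (∀ i ∈ Finset.Ico a b, w (i + 1) < w i)

instance MonoOnInterval.decidable (w : ℕ → ℤ) (a b : ℕ) : Decidable (MonoOnInterval w a b) := by
  unfold MonoOnInterval
  infer_instance

/-- The positions `a, …, b` form a maximal interval of `{0, …, n}` on which `w` is monotonic. -/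
def IsRun (w : ℕ → ℤ) (n a b : ℕ) : Prop :=
  a ≤ b ∧ b ≤ n ∧ MonoOnInterval w a b ∧
    ∀ a' ∈ Finset.Icc 0 a, ∀ b' ∈ Finset.Icc b n, MonoOnInterval w a' b' → a' = a ∧ b' = b

instance IsRun.decidable (w : ℕ → ℤ) (n a b : ℕ) : Decidable (IsRun w n a b) := by
  unfold IsRun
  infer_instance

/-- The number of runs of a signed permutation. -/
noncomputable def signedRuns {n : ℕ} (π : SignedPerm n) : ℕ :=
  ((Finset.range (n + 1) ×ˢ Finset.range (n + 1)).filter fun ab =>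
    IsRun (signedWord π) n ab.1 ab.2).card

/-- `T(n,k)`: up signed permutations of `{±1, …, ±n}`, that is, with `π(1) > 0`, that have
`k` runs. -/
noncomputable def numT (n k : ℕ) : ℕ :=
  (Finset.univ.filter fun π : SignedPerm n => 0 < signedWord π 1 ∧ signedRuns π = k).card

/-! ### Sign words and the insertion of an extremal letter -/

/-! Put `u = y ^ 2` and `v = z ^ 2`; then `D u = 2 * u * v` and `D v = 2 * u ^ 2`. All the
statistics depend only on the sign word of ascents and descents, and each is encoded by giving a
factor `u` to every change of sign and `v` to every repetition, with a prefactor `τ` such as `x ^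
2`.

Permutations grow by inserting a new extremal letter. A new maximum between two neighbours replaces
their sign, whatever it was, by an ascent and a descent; at the end it appends an ascent. A new
minimum does the opposite. So insertion is an operation on sign words alone, and the theorem reduces
to one fact: up to a constant factor, `D` of the weight of a word is the total weight of its
children. This is `sum_insSigns_true` for permutations and `sum_insSigns_both` for signed
permutations, and `iterate_derivation_sum` iterates it.

The expansions differ in `τ` and in what stands at the ends of the word: a virtual descent in front
(up-down runs), in addition a virtual ascent at the end (left peaks), the sum over both virtual
signs in front (alternating runs), or an unweighted first sign (signed permutations).

The rest identifies generated sign words with those of actual permutations (`sum_perm_words`,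
`sum_signed_words`) and the statistics with counts of sign changes (`altRuns_eq_signChanges`,
`card_peaks`, `card_isRun`). -/

/-- The sign words obtained from a sign word of `a w` by inserting, at all places after `a`, a
letter that is larger (`ε = true`) or smaller (`ε = false`) than all the others. -/
def insSigns (ε : Bool) : List Bool → List (List Bool)
  | [] => [[ε]]
  | c :: s => (ε :: (!ε) :: s) :: (insSigns ε s).map (c :: ·)

/-- The words obtained from those of `L` by `n` applications of `step`. -/
def descend (step : List Bool → List (List Bool)) (L : List (List Bool)) : ℕ → List (List Bool)
  | 0 => L
  | n + 1 => (descend step L n).flatMap step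

/-- The weight of a sign word read after the sign `c`: a factor `u` for each change of sign, a
factor `v` for each repetition, and the factor `τ` of the last sign. -/
def signWeight {R : Type*} [CommRing R] (u v : R) (τ : Bool → R) : Bool → List Bool → R
  | c, [] => τ c
  | c, d :: s => (if c = d then v else u) * signWeight u v τ d s

/-- The number of changes of sign in the sign word `c s`. -/
def signChanges : Bool → List Bool → ℕ
  | _, [] => 0
  | c, d :: s => (if c = d then 0 else 1) + signChanges d s

/-- The number of peaks in the sign word `c s`. -/
def signPeaks : Bool → List Bool → ℕ
  | _, [] => 0
  | c, d :: s => (if c && !d then 1 else 0) + signPeaks d s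

theorem insSigns_ne_nil (ε : Bool) (s t : List Bool) (ht : t ∈ insSigns ε s) : t ≠ [] := by
  cases s with
  | nil => simp_all [insSigns]
  | cons c s =>
    rcases List.mem_cons.1 ht with rfl | ht
    · simp
    · obtain ⟨r, -, rfl⟩ := List.mem_map.1 ht
      simp

theorem insSigns_map_not (ε : Bool) (s : List Bool) :
    insSigns (!ε) (s.map not) = (insSigns ε s).map (List.map not) := by
  induction s with
  | nil => rfl
  | cons c s ih => simp [insSigns, ih, Function.comp_def]

theorem descend_succ (step : List Bool → List (List Bool)) (L : List (List Bool)) (n : ℕ) :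
    descend step L (n + 1) = descend step (L.flatMap step) n := by
  induction n with
  | zero => rfl
  | succ n ih => rw [descend, ih]; rfl

/-- Negating a signed word exchanges insertion of a new maximum and of a new minimum. This symmetry
later isolates the words with a positive first letter as half of the total weight. -/
theorem descend_signed_perm (n : ℕ) :
    ((descend (fun s => insSigns true s ++ insSigns false s) [[]] n).map (List.map not)).Perm
      (descend (fun s => insSigns true s ++ insSigns false s) [[]] n) := by
  induction n with
  | zero => simp [descend]
  | succ n ih =>
    rw [descend, List.map_flatMap]
    refine List.Perm.trans ?_ (ih.flatMap_right _)
    rw [List.flatMap_map]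
    refine List.Perm.flatMap_left _ fun s _ => ?_
    have h1 := insSigns_map_not true s
    have h0 := insSigns_map_not false s
    simp only [Bool.not_true, Bool.not_false] at h1 h0
    rw [List.map_append, ← h1, ← h0]
    exact List.perm_append_comm

/-! ### Weights of sign words and the effect of one insertion -/

section Weights

variable {R : Type*} [CommRing R]

theorem signWeight_map_not (u v τ : R) (c : Bool) (s : List Bool) :
    signWeight u v (fun _ => τ) (!c) (s.map not) = signWeight u v (fun _ => τ) c s := by
  induction s generalizing c with
  | nil => rfl
  | cons d s ih => cases c <;> cases d <;> simp [signWeight, ← ih]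

theorem signWeight_const (u v τ : R) (c : Bool) (s : List Bool) :
    signChanges c s ≤ s.length ∧ signWeight u v (fun _ => τ) c s =
      τ * u ^ signChanges c s * v ^ (s.length - signChanges c s) := by
  induction s generalizing c with
  | nil => simp [signChanges, signWeight]
  | cons d s ih =>
    obtain ⟨h, e⟩ := ih d
    by_cases hcd : c = d
    · have h1 : s.length + 1 - (0 + signChanges d s) = s.length - signChanges d s + 1 := by
        omega
      simp only [signChanges, signWeight, hcd, if_true, e, List.length_cons, h1]
      exact ⟨by omega, by ring⟩
    · have h1 : s.length + 1 - (1 + signChanges d s) = s.length - signChanges d s := by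
        omega
      simp only [signChanges, signWeight, hcd, if_false, e, List.length_cons, h1]
      exact ⟨by omega, by ring⟩

/-- The factor `τ` chosen here is that of an additional final ascent. Peaks and valleys alternate,
so up to that ascent there are two changes per peak, plus one if the first sign is a descent. -/
theorem signWeight_peaks (u v : R) (c : Bool) (s : List Bool) :
    2 * signPeaks c s + (!c).toNat ≤ s.length + 1 ∧
      signWeight u v (fun e => if e then v else u) c s =
        u ^ (2 * signPeaks c s + (!c).toNat) *
          v ^ (s.length + 1 - (2 * signPeaks c s + (!c).toNat)) := by
  induction s generalizing c with
  | nil => cases c <;> simp [signPeaks, signWeight]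
  | cons d s ih =>
    obtain ⟨h, e⟩ := ih d
    cases c <;> cases d <;>
      simp only [signPeaks, signWeight, e, List.length_cons, Bool.not_true, Bool.not_false,
        Bool.toNat_true, Bool.toNat_false, Bool.and_true, Bool.and_false, if_true, if_false,
        Bool.false_eq_true, Bool.true_eq_false, add_zero, zero_add] at h ⊢
    · refine ⟨by omega, ?_⟩
      rw [show s.length + 1 + 1 - (2 * signPeaks false s + 1) =
        s.length + 1 - (2 * signPeaks false s + 1) + 1 by omega]
      ring
    · refine ⟨by omega, ?_⟩
      rw [show s.length + 1 + 1 - (2 * signPeaks true s + 1) =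
        s.length + 1 - 2 * signPeaks true s by omega]
      ring
    · refine ⟨by omega, ?_⟩
      rw [show s.length + 1 + 1 - 2 * (1 + signPeaks false s) =
        s.length + 1 - (2 * signPeaks false s + 1) by omega]
      ring
    · refine ⟨by omega, ?_⟩
      rw [show s.length + 1 + 1 - 2 * signPeaks true s =
        s.length + 1 - 2 * signPeaks true s + 1 by omega]
      ring

variable {K : Type*} [CommRing K] [Algebra K R] (D : Derivation K R R) {u v : R}
  (hu : D u = 2 * u * v) (hv : D v = 2 * u ^ 2)

include hu hv

/-- Insertion at the first sign `d` turns it into an ascent and a descent; later insertions are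
governed by the identity for the preceding sign `d`, so both preceding signs go through the
induction together. The correction terms after an ascent are what the first insertion and `D` of the
first factor leave over. -/
theorem sum_insSigns_true {τ : Bool → R} (h1 : D (τ true) = 2 * u * τ false)
    (h0 : D (τ false) = 2 * u * τ true) (s : List Bool) :
    2 * ((insSigns true s).map (signWeight u v τ false)).sum = D (signWeight u v τ false s) ∧
    2 * ((insSigns true s).map (signWeight u v τ true)).sum =
      D (signWeight u v τ true s) + 2 * v * signWeight u v τ true s
        - 2 * u * signWeight u v τ false s := by
  induction s with
  | nil =>
    simp [insSigns, signWeight, h0, h1]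
    constructor <;> ring
  | cons d s ih =>
    obtain ⟨i0, i1⟩ := ih
    cases d <;>
    simp only [insSigns, List.map_cons, List.map_map, Function.comp_def, signWeight,
      List.sum_cons, List.sum_map_mul_left, D.leibniz, smul_eq_mul, hu, hv, if_true, if_false,
      Bool.not_true, Bool.false_eq_true, Bool.true_eq_false] <;>
    constructor
    · linear_combination v * i0
    · linear_combination u * i0
    · linear_combination u * i1
    · linear_combination v * i1

/-- The two subtracted terms are the weights of the children with the new letter in front of the
first weighted sign's left end; they complete the sum in `iterate_signed_words`. -/
theorem sum_insSigns_both {τ : R} (h : D τ = (3 * u + v) * τ) (c : Bool) (s : List Bool) :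
    ((insSigns true s ++ insSigns false s).map (signWeight u v (fun _ => τ) c)).sum =
      D (signWeight u v (fun _ => τ) c s) - u * signWeight u v (fun _ => τ) c s
        - u * signWeight u v (fun _ => τ) (!c) s := by
  induction s generalizing c with
  | nil =>
    cases c <;> simp [insSigns, signWeight, h] <;> ring
  | cons d s ih =>
    have i0 := ih false
    have i1 := ih true
    cases c <;> cases d <;>
    simp only [insSigns, List.map_cons, List.map_map, Function.comp_def, signWeight,
      List.map_append, List.cons_append, List.sum_append,
      List.sum_cons, List.sum_map_mul_left, D.leibniz, smul_eq_mul, hu, hv, if_true, if_false,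
      Bool.not_true, Bool.not_false, Bool.false_eq_true, Bool.true_eq_false] at i0 i1 ⊢
    · linear_combination v * i0
    · linear_combination u * i1
    · linear_combination u * i0
    · linear_combination v * i1

end Weights

/-! ### Iterating the derivation along the insertion process -/

section Iteration

variable {R K : Type*} [CommRing R] [CommRing K] [Algebra K R] (D : Derivation K R R)

theorem descend_forall {step : List Bool → List (List Bool)} {L : List (List Bool)}
    {P : List Bool → Prop} (hL : ∀ s ∈ L, P s) (h : ∀ s, P s → ∀ t ∈ step s, P t) (n : ℕ) :
    ∀ s ∈ descend step L n, P s := by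
  induction n with
  | zero => exact hL
  | succ n ih =>
    intro s hs
    obtain ⟨r, hr, hs⟩ := List.mem_flatMap.1 hs
    exact h r (ih r hr) s hs

theorem iterate_derivation_sum {step : List Bool → List (List Bool)} {L : List (List Bool)}
    {W : List Bool → R} (a : ℕ) (P : List Bool → Prop) (hL : ∀ s ∈ L, P s)
    (hP : ∀ s, P s → ∀ t ∈ step s, P t)
    (h : ∀ s, P s → D (W s) = a * ((step s).map W).sum) (n : ℕ) :
    D^[n] (L.map W).sum = a ^ n * ((descend step L n).map W).sum := by
  induction n with
  | zero => simp [descend]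
  | succ n ih =>
    have hD : ∀ M : List (List Bool), (∀ s ∈ M, P s) →
        D (M.map W).sum = a * ((M.flatMap step).map W).sum := by
      intro M hM
      induction M with
      | nil => simp
      | cons s M ihM =>
        simp only [List.map_cons, List.sum_cons, map_add, List.flatMap_cons, List.map_append,
          List.sum_append, mul_add]
        rw [h s (hM s (by simp)), ihM fun t ht => hM t (by simp [ht])]
    have hc : D ((a : R) ^ n) = 0 := by
      rw [← Nat.cast_pow]
      exact D.map_natCast _
    rw [Function.iterate_succ_apply', ih, D.leibniz, hc, hD _ (descend_forall hL hP n)]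
    simp only [smul_eq_mul, mul_zero, add_zero, descend]
    ring

variable {u v : R} (hu : D u = 2 * u * v) (hv : D v = 2 * u ^ 2)

include hu hv

theorem iterate_zero_words {τ : Bool → R} (h1 : D (τ true) = 2 * u * τ false)
    (h0 : D (τ false) = 2 * u * τ true) (n : ℕ) :
    D^[n] (τ false) =
      2 ^ n * ((descend (insSigns true) [[]] n).map (signWeight u v τ false)).sum := by
  have := iterate_derivation_sum D (step := insSigns true) (L := [[]])
    (W := signWeight u v τ false) 2 (fun _ => True) (by simp) (by simp)
    (fun s _ => by exact_mod_cast (sum_insSigns_true D hu hv h1 h0 s).1.symm) n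
  simpa [signWeight] using this

/-- Without a fixed letter in front, the new maximum may also come first, which prepends a descent.
Summing over both virtual preceding signs makes this extra child absorb the correction terms of
`sum_insSigns_true`. The empty sign word then weighs `2 * u * τ`, whence the factor 2 on the left.
-/
theorem iterate_free_words {τ : R} (h : D τ = 2 * u * τ) (n : ℕ) :
    2 * D^[n] (u * τ) =
      2 ^ n * ((descend (fun s => (false :: s) :: insSigns true s) [[]] n).map fun s =>
        u * (signWeight u v (fun _ => τ) false s + signWeight u v (fun _ => τ) true s)).sum := by
  have := iterate_derivation_sum D (step := fun s => (false :: s) :: insSigns true s) (L := [[]])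
    (W := fun s =>
      u * (signWeight u v (fun _ => τ) false s + signWeight u v (fun _ => τ) true s))
    2 (fun _ => True) (by simp) (by simp)
    (fun s _ => by
      obtain ⟨i0, i1⟩ := sum_insSigns_true D hu hv (τ := fun _ => τ) h h s
      simp only [List.map_cons, List.sum_cons, List.sum_map_mul_left, List.sum_map_add,
        signWeight, D.leibniz, smul_eq_mul, hu, map_add, if_true, if_false, Bool.true_eq_false]
      push_cast
      linear_combination -u * i0 - u * i1) n
  rw [two_mul, ← iterate_map_add]
  simpa [signWeight, mul_add] using this

theorem iterate_signed_words {τ : R} (h : D τ = (3 * u + v) * τ) (n : ℕ) :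
    2 * D^[n] τ =
      ((descend (fun s => insSigns true s ++ insSigns false s) [[]] (n + 1)).map fun s =>
        signWeight u v (fun _ => τ) (s.headD true) s.tail).sum := by
  have := iterate_derivation_sum D (step := fun s => insSigns true s ++ insSigns false s)
    -- The first sign carries no weight, so the process starts after one insertion, from two words
    -- of weight `τ`. Words stay nonempty and the default of `headD` is never used.
    (L := [[true], [false]])
    (W := fun s => signWeight u v (fun _ => τ) (s.headD true) s.tail) 1 (fun s => s ≠ [])
    (by simp)
    (fun s _ t ht => (List.mem_append.1 ht).elim (insSigns_ne_nil _ _ _) (insSigns_ne_nil _ _ _))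
    (fun s hs => by
      obtain ⟨c, s, rfl⟩ := List.exists_cons_of_ne_nil hs
      have i := sum_insSigns_both D hu hv h c s
      cases c <;>
      simp only [insSigns, List.map_cons, List.map_append, List.cons_append, List.sum_append,
        List.map_map, Function.comp_def, List.headD_cons, List.tail_cons, List.sum_cons,
        signWeight, if_false, Bool.not_true, Bool.not_false, Bool.true_eq_false,
        Bool.false_eq_true] at i ⊢ <;>
      · push_cast
        linear_combination -i) n
  rw [two_mul, ← iterate_map_add, descend_succ]
  simpa [signWeight, insSigns] using this

end Iteration

/-! ### Words of permutations and of signed permutations -/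

/-- The sign word of the word `a l`: `true` for each ascent, `false` otherwise. -/
def signList : ℤ → List ℤ → List Bool
  | _, [] => []
  | a, b :: l => decide (a < b) :: signList b l

theorem length_signList (a : ℤ) (l : List ℤ) : (signList a l).length = l.length := by
  induction l generalizing a with
  | nil => rfl
  | cons b l ih => simp [signList, ih]

theorem map_signList_insert_max (M a : ℤ) (l : List ℤ) (ha : a < M) (hl : ∀ b ∈ l, b < M) :
    (l.permutations'Aux M).map (signList a) = insSigns true (signList a l) := by
  induction l generalizing a with
  | nil => simp [signList, insSigns, ha]
  | cons b l ih =>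
    have hb : b < M := hl b (by simp)
    simp [signList, insSigns, ha, hb.le, ← ih b hb fun c hc => hl c (by simp [hc]),
      Function.comp_def]

theorem map_signList_insert_min (M a : ℤ) (l : List ℤ) (ha : M < a) (hl : ∀ b ∈ l, M < b) :
    (l.permutations'Aux M).map (signList a) = insSigns false (signList a l) := by
  induction l generalizing a with
  | nil => simp [signList, insSigns, ha.le]
  | cons b l ih =>
    have hb : M < b := hl b (by simp)
    simp [signList, insSigns, ha.le, hb, ← ih b hb fun c hc => hl c (by simp [hc]),
      Function.comp_def]

/-- The list `n, n - 1, …, 1`. -/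
def downFrom : ℕ → List ℤ
  | 0 => []
  | n + 1 => ((n : ℤ) + 1) :: downFrom n

/-- The words of the signed permutations of `{±1, …, ±n}`. -/
def signedWords : ℕ → List (List ℤ)
  | 0 => [[]]
  | n + 1 => (signedWords n).flatMap fun l =>
      l.permutations'Aux ((n : ℤ) + 1) ++ l.permutations'Aux (-((n : ℤ) + 1))

theorem mem_downFrom {n : ℕ} {a : ℤ} : a ∈ downFrom n ↔ 1 ≤ a ∧ a ≤ n := by
  induction n with
  | zero => simp only [downFrom, List.not_mem_nil, Nat.cast_zero, false_iff]; omega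
  | succ n ih => simp only [downFrom, List.mem_cons, ih]; push_cast; omega

theorem length_downFrom (n : ℕ) : (downFrom n).length = n := by
  induction n with
  | zero => rfl
  | succ n ih => simp [downFrom, ih]

theorem nodup_downFrom (n : ℕ) : (downFrom n).Nodup := by
  induction n with
  | zero => simp [downFrom]
  | succ n ih =>
    rw [downFrom, List.nodup_cons, mem_downFrom]
    exact ⟨by omega, ih⟩

theorem perm_downFrom {n : ℕ} {l : List ℤ} (hl : l.Nodup) (hn : l.length = n)
    (h : ∀ a ∈ l, 1 ≤ a ∧ a ≤ n) : l.Perm (downFrom n) :=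
  (hl.subperm fun a ha => mem_downFrom.2 (h a ha)).perm_of_length_le
    (by rw [length_downFrom, hn])

theorem mem_permutations'Aux {α : Type*} {a : α} {l s : List α} :
    l ∈ s.permutations'Aux a ↔ ∃ l₁ l₂, s = l₁ ++ l₂ ∧ l = l₁ ++ a :: l₂ := by
  induction s generalizing l with
  | nil => simp +contextual [eq_comm]
  | cons b s ih =>
    simp only [List.permutations'Aux, List.mem_cons, List.mem_map, ih]
    constructor
    · rintro (rfl | ⟨_, ⟨l₁, l₂, rfl, rfl⟩, rfl⟩)
      · exact ⟨[], b :: s, rfl, rfl⟩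
      · exact ⟨b :: l₁, l₂, rfl, rfl⟩
    · rintro ⟨_ | ⟨c, l₁⟩, l₂, h, rfl⟩
      · left; simp at h; simp [h]
      · simp only [List.cons_append, List.cons.injEq] at h
        obtain ⟨rfl, rfl⟩ := h
        exact Or.inr ⟨_, ⟨l₁, l₂, rfl, rfl⟩, rfl⟩

theorem mem_signedWords {n : ℕ} {l : List ℤ} :
    l ∈ signedWords n ↔ (l.map abs).Perm (downFrom n) := by
  induction n generalizing l with
  | zero => simp [signedWords, downFrom]
  | succ n ih =>
    have hn : |(n : ℤ) + 1| = n + 1 := abs_of_nonneg (by omega)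
    simp only [signedWords, List.mem_flatMap, List.mem_append, mem_permutations'Aux, downFrom]
    constructor
    · rintro ⟨s, hs, ⟨l₁, l₂, rfl, rfl⟩ | ⟨l₁, l₂, rfl, rfl⟩⟩ <;>
      · rw [ih, List.map_append] at hs
        rw [List.map_append, List.map_cons]
        simp only [abs_neg, hn]
        exact List.perm_middle.trans (hs.cons _)
    · intro h
      have hm : (n : ℤ) + 1 ∈ l.map abs := h.mem_iff.2 (by simp)
      obtain ⟨a, ha, haa⟩ := List.mem_map.1 hm
      obtain ⟨l₁, l₂, rfl⟩ := List.append_of_mem ha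
      refine ⟨l₁ ++ l₂, ?_, ?_⟩
      · rw [ih, List.map_append]
        rw [List.map_append, List.map_cons, haa] at h
        exact (List.perm_middle.symm.trans h).cons_inv
      · rcases (abs_eq (by omega)).1 haa with rfl | rfl
        · exact Or.inl ⟨l₁, l₂, rfl, rfl⟩
        · exact Or.inr ⟨l₁, l₂, rfl, rfl⟩

theorem abs_le_of_mem_signedWords {n : ℕ} {l : List ℤ} (h : l ∈ signedWords n) :
    ∀ a ∈ l, 1 ≤ |a| ∧ |a| ≤ n := fun _ ha =>
  mem_downFrom.1 ((mem_signedWords.1 h).mem_iff.1 (List.mem_map_of_mem ha))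

theorem erase_of_mem_permutations'Aux {α : Type*} [DecidableEq α] {a : α} {l s : List α}
    (ha : a ∉ s) (h : l ∈ s.permutations'Aux a) : l.erase a = s := by
  obtain ⟨l₁, l₂, rfl, rfl⟩ := mem_permutations'Aux.1 h
  rw [List.mem_append, not_or] at ha
  rw [List.erase_append_right _ ha.1, List.erase_cons_head]

/-- A word determines its parent by erasing the letter of largest absolute value, and it cannot
contain that letter with both signs. -/
theorem nodup_signedWords (n : ℕ) : (signedWords n).Nodup := by
  induction n with
  | zero => simp [signedWords]
  | succ n ih =>
    have hmem : ∀ s ∈ signedWords n, ∀ a : ℤ, |a| = n + 1 → a ∉ s := fun s hs a ha h => by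
      have := (abs_le_of_mem_signedWords hs a h).2
      omega
    have hp : |(n : ℤ) + 1| = n + 1 := abs_of_nonneg (by omega)
    have hq : |-((n : ℤ) + 1)| = n + 1 := by rw [abs_neg, hp]
    have hmix : ∀ s ∈ signedWords n, ∀ t ∈ signedWords n,
        ∀ l, l ∈ s.permutations'Aux ((n : ℤ) + 1) → l ∉ t.permutations'Aux (-((n : ℤ) + 1)) := by
      intro s hs t ht l h h'
      obtain ⟨l₁, l₂, rfl, rfl⟩ := mem_permutations'Aux.1 h
      have h1 := hmem _ hs _ hq
      obtain ⟨m₁, m₂, -, e⟩ := mem_permutations'Aux.1 h'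
      have h2 : -((n : ℤ) + 1) ∈ l₁ ++ ((n : ℤ) + 1) :: l₂ := by rw [e]; simp
      simp only [List.mem_append, List.mem_cons, not_or] at h1 h2
      rcases h2 with h2 | h2 | h2
      · exact h1.1 h2
      · omega
      · exact h1.2 h2
    rw [signedWords, List.nodup_flatMap]
    refine ⟨fun s hs => List.Nodup.append
      (List.nodup_permutations'Aux_of_notMem _ _ (hmem s hs _ hp))
      (List.nodup_permutations'Aux_of_notMem _ _ (hmem s hs _ hq))
      fun l h h' => hmix s hs s hs l h h', ?_⟩
    refine ih.imp_of_mem fun {s t} hs ht hst => ?_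
    intro l h h'
    rcases List.mem_append.1 h with h | h <;> rcases List.mem_append.1 h' with h' | h'
    · exact hst ((erase_of_mem_permutations'Aux (hmem s hs _ hp) h).symm.trans
        (erase_of_mem_permutations'Aux (hmem t ht _ hp) h'))
    · exact hmix s hs t ht l h h'
    · exact hmix t ht s hs l h' h
    · exact hst ((erase_of_mem_permutations'Aux (hmem s hs _ hq) h).symm.trans
        (erase_of_mem_permutations'Aux (hmem t ht _ hq) h'))

theorem map_flatMap_congr {α β γ : Type*} (L : List α) (f : α → List β) (F : β → γ)
    (g : α → List γ) (h : ∀ a ∈ L, (f a).map F = g a) :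
    (L.flatMap f).map F = L.flatMap g := by
  rw [List.map_flatMap]
  exact List.flatMap_congr h

theorem signs_permutations (n : ℕ) :
    (downFrom n).permutations'.map (signList 0) = descend (insSigns true) [[]] n := by
  induction n with
  | zero => rfl
  | succ n ih =>
    rw [downFrom, List.permutations', descend, ← ih, List.flatMap_map]
    refine map_flatMap_congr _ _ _ _ fun l hl => map_signList_insert_max _ _ _ (by omega) ?_
    intro b hb
    have := (mem_downFrom.1 ((List.mem_permutations'.1 hl).mem_iff.1 hb)).2
    omega

theorem free_signs_permutations (n : ℕ) :
    (downFrom (n + 1)).permutations'.map (fun l => signList (l.headD 0) l.tail) =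
      descend (fun s => (false :: s) :: insSigns true s) [[]] n := by
  induction n with
  | zero => rfl
  | succ n ih =>
    rw [downFrom, List.permutations', descend, ← ih, List.flatMap_map]
    refine map_flatMap_congr _ _ _ _ fun l hl => ?_
    have hperm := List.mem_permutations'.1 hl
    have hb : ∀ b ∈ l, b < ((n + 1 : ℕ) : ℤ) + 1 := fun b hb => by
      have := (mem_downFrom.1 (hperm.mem_iff.1 hb)).2
      omega
    obtain _ | ⟨a, l⟩ := l
    · simpa [length_downFrom] using hperm.length_eq
    · have ha := hb a (by simp)
      simp only [List.permutations'Aux, List.map_cons, List.map_map, List.headD_cons,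
        List.tail_cons]
      rw [← map_signList_insert_max _ a l ha fun b h => hb b (by simp [h])]
      simp [signList, Function.comp_def]
      omega

theorem signs_signedWords (n : ℕ) :
    (signedWords n).map (signList 0) =
      descend (fun s => insSigns true s ++ insSigns false s) [[]] n := by
  induction n with
  | zero => rfl
  | succ n ih =>
    rw [signedWords, descend, ← ih, List.flatMap_map]
    refine map_flatMap_congr _ _ _ _ fun l hl => ?_
    rw [List.map_append, map_signList_insert_max _ _ _ (by omega),
      map_signList_insert_min _ _ _ (by omega)]
    all_goals
      intro b hb
      have := abs_le.1 (abs_le_of_mem_signedWords hl b hb).2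
      omega

theorem sum_words {R α : Type*} [AddCommMonoid R] [Fintype α] {W : α → List ℤ}
    (hW : Function.Injective W) {L : List (List ℤ)} (hL : L.Nodup)
    (h : ∀ l, l ∈ L ↔ ∃ a, W a = l) (F : List ℤ → R) :
    ∑ a, F (W a) = (L.map F).sum := by
  classical
  rw [← List.sum_toFinset F hL, ← Finset.sum_image (s := Finset.univ) fun a _ b _ e => hW e]
  congr 1
  ext l
  simp [h]

/-- The word `w(p) w(p + 1) ⋯ w(p + m - 1)`. -/
def wordList (w : ℕ → ℤ) (p m : ℕ) : List ℤ := (List.range' p m).map w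

theorem permWord_add_one {n : ℕ} (π : Equiv.Perm (Fin n)) (i : Fin n) :
    permWord π (i + 1) = (π i : ℕ) + 1 := by
  simp [permWord]

theorem permWord_injOn {n : ℕ} (π : Equiv.Perm (Fin n)) {i j : ℕ} (hi : i ≤ n) (hj : j ≤ n)
    (h : permWord π i = permWord π j) : i = j := by
  obtain _ | i := i <;> obtain _ | j := j
  · rfl
  · have := permWord_add_one π ⟨j, hj⟩
    rw [← h] at this
    simp only [permWord] at this
    simp at this
    omega
  · have := permWord_add_one π ⟨i, hi⟩
    rw [h] at this
    simp only [permWord] at this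
    simp at this
    omega
  · rw [show i + 1 = ((⟨i, hi⟩ : Fin n) : ℕ) + 1 from rfl,
      show j + 1 = ((⟨j, hj⟩ : Fin n) : ℕ) + 1 from rfl, permWord_add_one, permWord_add_one] at h
    have h2 : π ⟨i, hi⟩ = π ⟨j, hj⟩ := Fin.ext (by omega)
    have := congrArg Fin.val (π.injective h2)
    simpa using this

theorem sum_perm_words {R : Type*} [AddCommMonoid R] (n : ℕ) (F : List ℤ → R) :
    ∑ π : Equiv.Perm (Fin n), F (wordList (permWord π) 1 n) =
      ((downFrom n).permutations'.map F).sum := by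
  have hinj : Function.Injective fun π : Equiv.Perm (Fin n) => wordList (permWord π) 1 n := by
    intro π σ h
    ext i
    have := List.map_inj_left.1 h (i + 1) (by simp; omega)
    rw [permWord_add_one, permWord_add_one] at this
    omega
  have hmem : ∀ π : Equiv.Perm (Fin n),
      wordList (permWord π) 1 n ∈ (downFrom n).permutations' := by
    intro π
    rw [List.mem_permutations']
    refine perm_downFrom ?_ (by simp [wordList]) ?_
    · refine (List.nodup_range' (s := 1) (n := n)).map_on fun i hi j hj h => ?_
      simp only [List.mem_range'_1] at hi hj
      exact permWord_injOn π (by omega) (by omega) h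
    · intro a ha
      obtain ⟨i, hi, rfl⟩ := List.mem_map.1 ha
      simp only [List.mem_range'_1] at hi
      have := permWord_add_one π ⟨i - 1, by omega⟩
      have e : ((⟨i - 1, by omega⟩ : Fin n) : ℕ) + 1 = i := by simp; omega
      rw [e] at this
      omega
  have hnd : (downFrom n).permutations'.Nodup :=
    (List.permutations_perm_permutations' _).nodup_iff.1
      (List.nodup_permutations _ (nodup_downFrom n))
  -- Surjectivity by counting: both sides have `n!` elements.
  have hcard : (Finset.univ.image fun π : Equiv.Perm (Fin n) => wordList (permWord π) 1 n) =
      (downFrom n).permutations'.toFinset := by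
    refine Finset.eq_of_subset_of_card_le (fun l hl => ?_) ?_
    · obtain ⟨π, -, rfl⟩ := Finset.mem_image.1 hl
      exact List.mem_toFinset.2 (hmem π)
    · rw [List.toFinset_card_of_nodup hnd, Finset.card_image_of_injective _ hinj,
        ← (List.permutations_perm_permutations' _).length_eq, List.length_permutations,
        length_downFrom, Finset.card_univ, Fintype.card_perm, Fintype.card_fin]
  refine sum_words hinj hnd (fun l => ?_) F
  rw [← List.mem_toFinset, ← hcard]
  simp

/-! ### Words of signed permutations -/

theorem mem_pmSet {n : ℕ} {a : ℤ} : a ∈ pmSet n ↔ 1 ≤ |a| ∧ |a| ≤ n := by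
  rw [pmSet, Finset.mem_erase, Finset.mem_Icc, ← abs_le, ← abs_pos]
  omega

theorem signedWord_eq {n : ℕ} (π : SignedPerm n) (i : pmSet n) (k : ℕ) (h : (i : ℤ) = k) :
    signedWord π k = π.1 i := by
  obtain ⟨i, hi⟩ := i
  subst h
  simp [signedWord, hi]

theorem signedWord_abs {n : ℕ} (π : SignedPerm n) {i : ℕ} (h1 : 1 ≤ i) (hn : i ≤ n) :
    1 ≤ |signedWord π i| ∧ |signedWord π i| ≤ n := by
  rw [signedWord_eq π ⟨i, mem_pmSet.2 (by rw [Nat.abs_cast]; omega)⟩ i rfl, ← mem_pmSet]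
  exact Subtype.property _

theorem signedWord_abs_injOn {n : ℕ} (π : SignedPerm n) {i j : ℕ} (hi : i ≤ n) (hj : j ≤ n)
    (h : |signedWord π i| = |signedWord π j|) : i = j := by
  have h0 : signedWord π 0 = 0 := by simp [signedWord, mem_pmSet]
  have hpos : ∀ k, k ≤ n → k ≠ 0 → |signedWord π k| ≠ 0 := fun k hk h0 => by
    have := (signedWord_abs π (by omega) hk).1
    omega
  by_cases hi0 : i = 0 <;> by_cases hj0 : j = 0
  · omega
  · subst hi0
    rw [h0, abs_zero] at h
    exact absurd h.symm (hpos j hj hj0)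
  · subst hj0
    rw [h0, abs_zero] at h
    exact absurd h (hpos i hi hi0)
  · have mi : (i : ℤ) ∈ pmSet n := mem_pmSet.2 (by rw [Nat.abs_cast]; omega)
    have mj : (j : ℤ) ∈ pmSet n := mem_pmSet.2 (by rw [Nat.abs_cast]; omega)
    have mj' : -(j : ℤ) ∈ pmSet n := mem_pmSet.2 (by rw [abs_neg, Nat.abs_cast]; omega)
    rw [signedWord_eq π ⟨i, mi⟩ i rfl, signedWord_eq π ⟨j, mj⟩ j rfl] at h
    rcases abs_eq_abs.1 h with h | h
    · have := congrArg Subtype.val (π.1.injective (Subtype.ext h))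
      simpa using this
    · rw [← π.2 ⟨j, mj⟩ ⟨-j, mj'⟩ rfl] at h
      have := congrArg Subtype.val (π.1.injective (Subtype.ext h))
      simp only at this
      omega

theorem sum_signed_words {R : Type*} [AddCommMonoid R] (n : ℕ) (F : List ℤ → R) :
    ∑ π : SignedPerm n, F (wordList (signedWord π) 1 n) = ((signedWords n).map F).sum := by
  refine sum_words ?_ (nodup_signedWords n) (fun l => ?_) F
  · intro π σ h
    have hw : ∀ i : ℕ, 1 ≤ i → i ≤ n → signedWord π i = signedWord σ i := fun i h1 hn =>
      List.map_inj_left.1 h i (by simp; omega)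
    have hpos : ∀ (a : pmSet n), 0 < (a : ℤ) → (π.1 a : ℤ) = σ.1 a := by
      intro a ha
      have hm := mem_pmSet.1 a.2
      rw [abs_of_pos ha] at hm
      have e : (a : ℤ) = ((a : ℤ).toNat : ℕ) := by omega
      rw [← signedWord_eq π a _ e, ← signedWord_eq σ a _ e]
      exact hw _ (by omega) (by omega)
    refine Subtype.ext (Equiv.ext fun a => Subtype.ext ?_)
    rcases lt_trichotomy (a : ℤ) 0 with ha | ha | ha
    · have hm : -(a : ℤ) ∈ pmSet n := by
        have := mem_pmSet.1 a.2
        rwa [mem_pmSet, abs_neg]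
      have hb := hpos ⟨-a, hm⟩ (by simpa using ha)
      rw [π.2 a ⟨-a, hm⟩ rfl, σ.2 a ⟨-a, hm⟩ rfl] at hb
      omega
    · have := (mem_pmSet.1 a.2).1
      rw [ha, abs_zero] at this
      omega
    · exact hpos a ha
  · rw [mem_signedWords]
    constructor
    · intro h
      have hlen : l.length = n := by simpa [length_downFrom] using h.length_eq
      have hnd : (l.map abs).Nodup := h.nodup_iff.2 (nodup_downFrom n)
      have hval : ∀ a ∈ l, 1 ≤ |a| ∧ |a| ≤ n := abs_le_of_mem_signedWords (mem_signedWords.2 h)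
      -- The odd extension of the word `l`; list indices start at 0, and the default of `getD` is
      -- never reached on `pmSet n`.
      let f : ℤ → ℤ := fun j => j.sign * l.getD (j.natAbs - 1) 0
      have hget : ∀ j ∈ pmSet n, ∃ h : j.natAbs - 1 < l.length, f j = j.sign * l[j.natAbs - 1] := by
        intro j hj
        have := mem_pmSet.1 hj
        rw [Int.abs_eq_natAbs] at this
        have hlt : j.natAbs - 1 < l.length := by omega
        exact ⟨hlt, by simp only [f]; rw [List.getD_eq_getElem _ _ hlt]⟩
      have hsgn : ∀ j ∈ pmSet n, |j.sign| = 1 := by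
        intro j hj
        have h1 := (mem_pmSet.1 hj).1
        rcases lt_trichotomy j 0 with h | rfl | h
        · simp [Int.sign_eq_neg_one_of_neg h]
        · simp at h1
        · simp [Int.sign_eq_one_of_pos h]
      have hmaps : ∀ j : pmSet n, f j ∈ pmSet n := by
        intro j
        obtain ⟨hlt, e⟩ := hget j j.2
        rw [mem_pmSet, e, abs_mul, hsgn j j.2, one_mul]
        exact hval _ (List.getElem_mem _)
      have hneg : ∀ j, f (-j) = -f j := fun j => by simp [f]
      have hfinj : Function.Injective fun j : pmSet n => (⟨f j, hmaps j⟩ : pmSet n) := by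
        intro i j hij
        have hij' : f i = f j := congrArg Subtype.val hij
        obtain ⟨hi, ei⟩ := hget i i.2
        obtain ⟨hj, ej⟩ := hget j j.2
        have habs : |l[(i : ℤ).natAbs - 1]| = |l[(j : ℤ).natAbs - 1]| := by
          have := congrArg abs hij'
          rwa [ei, ej, abs_mul, abs_mul, hsgn i i.2, hsgn j j.2, one_mul, one_mul] at this
        have hidx : (i : ℤ).natAbs - 1 = (j : ℤ).natAbs - 1 := by
          refine (hnd.getElem_inj_iff (hi := by simpa using hi) (hj := by simpa using hj)).1 ?_
          simpa using habs
        have mi := mem_pmSet.1 i.2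
        have mj := mem_pmSet.1 j.2
        rw [Int.abs_eq_natAbs] at mi mj
        rcases Int.natAbs_eq_natAbs_iff.1 (show (i : ℤ).natAbs = (j : ℤ).natAbs by omega) with e | e
        · exact Subtype.ext e
        · have hz : f j = 0 := by
            rw [e, hneg] at hij'
            omega
          have := (mem_pmSet.1 (hmaps j)).1
          rw [hz, abs_zero] at this
          omega
      refine ⟨⟨Equiv.ofBijective _ (Finite.injective_iff_bijective.1 hfinj), ?_⟩, ?_⟩
      · intro i j hij
        simp [hij, hneg]
      · refine List.ext_getElem (by simp [wordList, hlen]) fun i h1 h2 => ?_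
        have mi : ((1 + i : ℕ) : ℤ) ∈ pmSet n := mem_pmSet.2 (by rw [Nat.abs_cast]; omega)
        simp only [wordList, List.getElem_map, List.getElem_range', one_mul]
        rw [signedWord_eq _ ⟨((1 + i : ℕ) : ℤ), mi⟩ _ rfl]
        obtain ⟨hlt, e⟩ := hget _ mi
        simp only [Equiv.ofBijective_apply, e]
        rw [Int.sign_eq_one_of_pos (by omega), one_mul]
        congr 1
        omega
    · rintro ⟨π, rfl⟩
      refine perm_downFrom ?_ (by simp [wordList]) ?_
      · rw [wordList, List.map_map]
        refine (List.nodup_range' (s := 1) (n := n)).map_on fun i hi j hj h => ?_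
        simp only [List.mem_range'_1] at hi hj
        exact signedWord_abs_injOn π (by omega) (by omega) h
      · intro a ha
        simp only [wordList, List.map_map, List.mem_map, List.mem_range'_1,
          Function.comp_apply] at ha
        obtain ⟨i, hi, rfl⟩ := ha
        exact signedWord_abs π (by omega) (by omega)

/-! ### Statistics in terms of sign words -/

theorem wordList_succ (w : ℕ → ℤ) (p m : ℕ) :
    wordList w p (m + 1) = w p :: wordList w (p + 1) m := by
  simp [wordList, List.range'_succ]

/-- Distinct neighbours ensure that `false` in the sign word means a strict descent. -/
theorem card_directionChanges (w : ℕ → ℤ) (p m : ℕ)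
    (h : ∀ i, p ≤ i → i ≤ p + m → w i ≠ w (i + 1)) :
    ((Finset.Ioo p (p + m + 1)).filter fun i =>
      (w (i - 1) < w i ∧ w (i + 1) < w i) ∨ (w i < w (i - 1) ∧ w i < w (i + 1))).card =
      signChanges (decide (w p < w (p + 1))) (signList (w (p + 1)) (wordList w (p + 2) m)) := by
  induction m generalizing p with
  | zero =>
    have : Finset.Ioo p (p + 0 + 1) = ∅ := by ext i; simp
    rw [this]
    simp [wordList, signList, signChanges]
  | succ m ih =>
    have e : Finset.Ioo p (p + (m + 1) + 1) =
        insert (p + 1) (Finset.Ioo (p + 1) (p + 1 + m + 1)) := by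
      ext i; simp only [Finset.mem_insert, Finset.mem_Ioo]; omega
    rw [e, Finset.filter_insert, wordList_succ, signList, signChanges,
      ← ih (p + 1) fun i h1 h2 => h i (by omega) (by omega)]
    have h1 := h p (by omega) (by omega)
    have h2 := h (p + 1) (by omega) (by omega)
    simp only [Nat.add_sub_cancel]
    rw [show p + 2 = p + 1 + 1 from rfl]
    by_cases a : w p < w (p + 1) <;> by_cases b : w (p + 1) < w (p + 1 + 1)
    · rw [if_neg (by omega), if_pos (by simp [a, b]), zero_add]
    · rw [if_pos (by omega), if_neg (by simp [a, b]), Finset.card_insert_of_notMem (by simp),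
        add_comm]
    · rw [if_pos (by omega), if_neg (by simp [a, b]), Finset.card_insert_of_notMem (by simp),
        add_comm]
    · rw [if_neg (by omega), if_pos (by simp [a, b]), zero_add]

theorem altRuns_eq_signChanges (w : ℕ → ℤ) (p m : ℕ)
    (h : ∀ i, p ≤ i → i ≤ p + m → w i ≠ w (i + 1)) :
    altRuns w p (p + m + 1) =
      signChanges (decide (w p < w (p + 1))) (signList (w (p + 1)) (wordList w (p + 2) m)) + 1 := by
  rw [altRuns, if_pos (by omega), card_directionChanges w p m h]

theorem card_peaks (w : ℕ → ℤ) (p m : ℕ) (h : ∀ i, p ≤ i → i ≤ p + m → w i ≠ w (i + 1)) :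
    ((Finset.Ico (p + 1) (p + 1 + m)).filter fun i =>
      w (i - 1) < w i ∧ w (i + 1) < w i).card =
      signPeaks (decide (w p < w (p + 1))) (signList (w (p + 1)) (wordList w (p + 2) m)) := by
  induction m generalizing p with
  | zero => simp [wordList, signList, signPeaks]
  | succ m ih =>
    have e : Finset.Ico (p + 1) (p + 1 + (m + 1)) =
        insert (p + 1) (Finset.Ico (p + 1 + 1) (p + 1 + 1 + m)) := by
      ext i; simp only [Finset.mem_insert, Finset.mem_Ico]; omega
    rw [e, Finset.filter_insert, wordList_succ, signList, signPeaks,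
      ← ih (p + 1) fun i h1 h2 => h i (by omega) (by omega)]
    have h2 := h (p + 1) (by omega) (by omega)
    simp only [Nat.add_sub_cancel]
    rw [show p + 2 = p + 1 + 1 from rfl]
    by_cases a : w p < w (p + 1) <;> by_cases b : w (p + 1) < w (p + 1 + 1)
    · rw [if_neg (by omega), if_neg (by simp [b]), zero_add]
    · rw [if_pos (by omega), if_pos (by simp [a, b]), Finset.card_insert_of_notMem (by simp),
        add_comm]
    · rw [if_neg (by omega), if_neg (by simp [b]), zero_add]
    · rw [if_neg (by omega), if_neg (by simp [a]), zero_add]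

/-! ### Maximal monotonic intervals and alternating runs -/

theorem MonoOnInterval.mono {w : ℕ → ℤ} {a b a' b' : ℕ} (h : MonoOnInterval w a b)
    (ha : a ≤ a') (hb : b' ≤ b) : MonoOnInterval w a' b' := by
  have : Finset.Ico a' b' ⊆ Finset.Ico a b := Finset.Ico_subset_Ico ha hb
  exact h.imp (fun h i hi => h i (this hi)) (fun h i hi => h i (this hi))

theorem monoOnInterval_succ {w : ℕ → ℤ} {a : ℕ} (h : w a ≠ w (a + 1)) :
    MonoOnInterval w a (a + 1) := by
  rcases lt_or_gt_of_ne h with h | h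
  · exact Or.inl fun i hi => by
      obtain rfl : i = a := by simp at hi; omega
      exact h
  · exact Or.inr fun i hi => by
      obtain rfl : i = a := by simp at hi; omega
      exact h

theorem MonoOnInterval.of_pred {w : ℕ → ℤ} {a b : ℕ} (h : MonoOnInterval w (a + 1) b)
    (hab : a + 1 < b) (h1 : w a ≠ w (a + 1))
    (hc : ¬((w a < w (a + 1) ∧ w (a + 2) < w (a + 1)) ∨
      (w (a + 1) < w a ∧ w (a + 1) < w (a + 2)))) : MonoOnInterval w a b := by
  rcases h with h | h
  · have h2 := h (a + 1) (by simp [hab])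
    refine Or.inl fun i hi => ?_
    rw [Finset.mem_Ico] at hi
    rcases eq_or_lt_of_le hi.1 with rfl | hlt
    · by_contra hcon
      exact hc (Or.inr ⟨by omega, h2⟩)
    · exact h i (by rw [Finset.mem_Ico]; omega)
  · have h2 := h (a + 1) (by simp [hab])
    refine Or.inr fun i hi => ?_
    rw [Finset.mem_Ico] at hi
    rcases eq_or_lt_of_le hi.1 with rfl | hlt
    · by_contra hcon
      exact hc (Or.inl ⟨by omega, h2⟩)
    · exact h i (by rw [Finset.mem_Ico]; omega)

theorem not_monoOnInterval_of_directionChange {w : ℕ → ℤ} {a : ℕ}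
    (hc : (w a < w (a + 1) ∧ w (a + 2) < w (a + 1)) ∨
      (w (a + 1) < w a ∧ w (a + 1) < w (a + 2))) : ¬MonoOnInterval w a (a + 2) := by
  rintro (h | h) <;>
  · have h1 := h a (by simp)
    have h2 := h (a + 1) (by simp)
    rw [show a + 1 + 1 = a + 2 from rfl] at h2
    omega

theorem IsRun.lt {w : ℕ → ℤ} {n a b : ℕ} (hn : 0 < n) (h : ∀ i < n, w i ≠ w (i + 1))
    (hr : IsRun w n a b) : a < b := by
  obtain ⟨hab, hbn, -, hmax⟩ := hr
  refine lt_of_le_of_ne hab ?_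
  rintro rfl
  rcases Nat.lt_or_ge a n with ha | ha
  · have := hmax a (by simp) (a + 1) (by simp; omega) (monoOnInterval_succ (h a ha))
    omega
  · obtain ⟨a, rfl⟩ := Nat.exists_eq_add_of_lt (hn.trans_le ha)
    rw [zero_add] at *
    have := hmax a (by simp) (a + 1) (by simp; omega) (monoOnInterval_succ (h a (by omega)))
    omega

theorem IsRun.eq_of_left_eq {w : ℕ → ℤ} {n a b b' : ℕ} (hr : IsRun w n a b)
    (hr' : IsRun w n a b') : b = b' := by
  obtain ⟨hab, hbn, hm, hmax⟩ := hr
  obtain ⟨hab', hbn', hm', hmax'⟩ := hr'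
  rcases le_total b b' with h | h
  · exact (hmax a (by simp) b' (by simp [h, hbn']) hm').2.symm
  · exact (hmax' a (by simp) b (by simp [h, hbn]) hm).2

/-- A monotonic interval with at least two positions extends to the left exactly when its left end
is neither 0 nor a change of direction. -/
theorem exists_isRun_iff {w : ℕ → ℤ} {n : ℕ} (hn : 0 < n) (h : ∀ i < n, w i ≠ w (i + 1)) (a : ℕ) :
    (∃ b, IsRun w n a b) ↔ a = 0 ∨ a ∈ (Finset.Ioo 0 n).filter fun i =>
      (w (i - 1) < w i ∧ w (i + 1) < w i) ∨ (w i < w (i - 1) ∧ w i < w (i + 1)) := by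
  rw [Finset.mem_filter, Finset.mem_Ioo]
  constructor
  · rintro ⟨b, hr⟩
    have hlt := hr.lt hn h
    obtain ⟨hab, hbn, hm, hmax⟩ := hr
    obtain _ | a := a
    · exact Or.inl rfl
    · refine Or.inr ⟨by omega, ?_⟩
      by_contra hc
      have := hmax a (by simp) b (by simp [hbn]) (hm.of_pred hlt (h a (by omega)) hc)
      omega
  · intro ha
    have han : a < n := by omega
    -- The right end of the run is the last `b` up to which `w` stays monotonic from `a`.
    let P : ℕ → Prop := fun b => MonoOnInterval w a b
    have hP : P (a + 1) := monoOnInterval_succ (h a han)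
    have hle : a + 1 ≤ Nat.findGreatest P n := Nat.le_findGreatest han hP
    have hspec : P (Nat.findGreatest P n) := Nat.findGreatest_spec (m := a + 1) han hP
    refine ⟨Nat.findGreatest P n, by omega, Nat.findGreatest_le n, hspec, ?_⟩
    intro a' ha' b' hb' hm
    rw [Finset.mem_Icc] at ha' hb'
    refine ⟨?_, le_antisymm (Nat.le_findGreatest hb'.2 (hm.mono ha'.2 le_rfl)) hb'.1⟩
    by_contra hne
    obtain _ | a := a
    · omega
    · rcases ha with ha | ⟨-, hc⟩
      · omega
      · exact not_monoOnInterval_of_directionChange hc (hm.mono (by omega) (by omega))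

/-- A run is determined by its left end, so runs biject with 0 and the changes of direction. -/
theorem card_isRun {w : ℕ → ℤ} {n : ℕ} (hn : 0 < n) (h : ∀ i < n, w i ≠ w (i + 1)) :
    ((Finset.range (n + 1) ×ˢ Finset.range (n + 1)).filter fun ab => IsRun w n ab.1 ab.2).card =
      altRuns w 0 n := by
  rw [altRuns, if_pos hn, ← Finset.card_insert_of_notMem (a := 0) (by simp)]
  refine Finset.card_bij (fun ab _ => ab.1) ?_ ?_ ?_
  · rintro ⟨a, b⟩ hab
    exact Finset.mem_insert.2 ((exists_isRun_iff hn h a).1 ⟨b, (Finset.mem_filter.1 hab).2⟩)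
  · rintro ⟨a, b⟩ hab ⟨a', b'⟩ hab' (rfl : a = a')
    exact congrArg _ ((Finset.mem_filter.1 hab).2.eq_of_left_eq (Finset.mem_filter.1 hab').2)
  · intro a ha
    obtain ⟨b, hr⟩ := (exists_isRun_iff hn h a).2 (Finset.mem_insert.1 ha)
    refine ⟨(a, b), Finset.mem_filter.2 ⟨?_, hr⟩, rfl⟩
    obtain ⟨h1, h2, -⟩ := hr
    simp only [Finset.mem_product, Finset.mem_range]
    omega

theorem sum_eq_sum_card_mul {R α : Type*} [CommRing R] (S : Finset α) (g : α → ℕ) (K : Finset ℕ)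
    (h : ∀ a ∈ S, g a ∈ K) (f : ℕ → R) :
    ∑ a ∈ S, f (g a) = ∑ k ∈ K, ((S.filter fun a => g a = k).card : R) * f k := by
  rw [← Finset.sum_fiberwise_of_maps_to h]
  refine Finset.sum_congr rfl fun k _ => ?_
  rw [Finset.sum_congr rfl (g := fun _ => f k), Finset.sum_const, nsmul_eq_mul]
  intro a ha
  rw [(Finset.mem_filter.1 ha).2]

theorem length_wordList (w : ℕ → ℤ) (p m : ℕ) : (wordList w p m).length = m := by
  simp [wordList]

theorem permWord_one_pos {m : ℕ} (π : Equiv.Perm (Fin (m + 1))) : 0 < permWord π 1 := by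
  have := permWord_add_one π 0
  simp only [Fin.val_zero, zero_add] at this
  omega

theorem permWord_zero {n : ℕ} (π : Equiv.Perm (Fin n)) : permWord π 0 = 0 := by
  simp [permWord]

theorem permWord_ne {n : ℕ} (π : Equiv.Perm (Fin n)) {i : ℕ} (hi : i < n) :
    permWord π i ≠ permWord π (i + 1) := fun h => by
  have := permWord_injOn π hi.le hi h
  omega

/-- The word starts with an ascent from 0, so the virtual descent in front contributes exactly the
extra 1 in `altRuns`. -/
theorem altRuns_permWord {n : ℕ} (hn : 1 ≤ n) (π : Equiv.Perm (Fin n)) :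
    altRuns (permWord π) 0 n = signChanges false (signList 0 (wordList (permWord π) 1 n)) := by
  obtain ⟨m, rfl⟩ := Nat.exists_eq_add_of_le' hn
  have h := altRuns_eq_signChanges (permWord π) 0 m fun i _ hi => permWord_ne π (by omega)
  simp only [zero_add] at h
  rw [h, permWord_zero, wordList_succ, signList, signChanges]
  simp [permWord_one_pos, add_comm]

theorem leftPeaks_eq_signPeaks {n : ℕ} (hn : 1 ≤ n) (π : Equiv.Perm (Fin n)) :
    leftPeaks π = signPeaks false (signList 0 (wordList (permWord π) 1 n)) := by
  obtain ⟨m, rfl⟩ := Nat.exists_eq_add_of_le' hn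
  have h := card_peaks (permWord π) 0 m fun i _ hi => permWord_ne π (by omega)
  rw [zero_add, add_comm 1 m] at h
  rw [leftPeaks, h, permWord_zero, wordList_succ, signList, signPeaks]
  simp

theorem signedWord_zero {n : ℕ} (π : SignedPerm n) : signedWord π 0 = 0 := by
  simp [signedWord, mem_pmSet]

theorem signedRuns_eq_signChanges {m : ℕ} (π : SignedPerm (m + 1)) :
    signedRuns π = signChanges (decide (0 < signedWord π 1))
      (signList (signedWord π 1) (wordList (signedWord π) 2 m)) + 1 := by
  have hne : ∀ i < m + 1, signedWord π i ≠ signedWord π (i + 1) := fun i hi h => by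
    have := signedWord_abs_injOn π hi.le hi (congrArg abs h)
    omega
  have h := altRuns_eq_signChanges (signedWord π) 0 m fun i _ hi => hne i (by omega)
  simp only [zero_add, signedWord_zero] at h
  rw [signedRuns, card_isRun (by omega) hne, h]

theorem eq_of_two_mul_eq {R : Type*} [CommRing R] [Algebra ℚ R] {a b : R}
    (h : 2 * a = 2 * b) : a = b := by
  have h2 : IsUnit (2 : R) := by
    have := (IsUnit.mk0 (2 : ℚ) two_ne_zero).map (algebraMap ℚ R)
    rwa [map_ofNat] at this
  exact h2.mul_left_cancel h

/-! ### Expansions with the permutation statistics as coefficients -/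

section Expansions

variable {R : Type*} [CommRing R] [Algebra ℚ R] (D : Derivation ℚ R R) {u v : R}
  (hu : D u = 2 * u * v) (hv : D v = 2 * u ^ 2)

include hu hv

theorem iterate_eq_sum_numM {τ : R} (h : D τ = 2 * u * τ) {n : ℕ} (hn : 1 ≤ n) :
    D^[n] τ = 2 ^ n * τ * ∑ k ∈ Finset.Icc 0 n, (numM n k : R) * (u ^ k * v ^ (n - k)) := by
  have hstat : ∀ π : Equiv.Perm (Fin n), altRuns (permWord π) 0 n ≤ n ∧
      signWeight u v (fun _ => τ) false (signList 0 (wordList (permWord π) 1 n)) =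
        τ * (u ^ altRuns (permWord π) 0 n * v ^ (n - altRuns (permWord π) 0 n)) := fun π => by
    have := signWeight_const u v τ false (signList 0 (wordList (permWord π) 1 n))
    rwa [← altRuns_permWord hn, length_signList, length_wordList, mul_assoc] at this
  have hsum := sum_eq_sum_card_mul Finset.univ
    (fun π : Equiv.Perm (Fin n) => altRuns (permWord π) 0 n) (Finset.Icc 0 n)
    (fun π _ => Finset.mem_Icc.2 ⟨Nat.zero_le _, (hstat π).1⟩) fun k => u ^ k * v ^ (n - k)
  simp only [numM]
  rw [iterate_zero_words D hu hv (τ := fun _ => τ) h h n, ← signs_permutations, List.map_map,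
    ← sum_perm_words, ← hsum, mul_assoc]
  refine congrArg _ ?_
  rw [Finset.mul_sum]
  exact Finset.sum_congr rfl fun π _ => (hstat π).2

theorem iterate_eq_sum_numP {n : ℕ} (hn : 1 ≤ n) :
    D^[n] u = 2 ^ n * u *
      ∑ k ∈ Finset.Icc 0 (n / 2), (numP n k : R) * (u ^ (2 * k) * v ^ (n - 2 * k)) := by
  have hstat : ∀ π : Equiv.Perm (Fin n), 2 * leftPeaks π ≤ n ∧
      signWeight u v (fun e => if e then v else u) false
        (signList 0 (wordList (permWord π) 1 n)) =
        u * (u ^ (2 * leftPeaks π) * v ^ (n - 2 * leftPeaks π)) := fun π => by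
    have := signWeight_peaks u v false (signList 0 (wordList (permWord π) 1 n))
    rw [← leftPeaks_eq_signPeaks hn, length_signList, length_wordList, Bool.not_false,
      Bool.toNat_true, Nat.add_sub_add_right] at this
    exact ⟨by omega, by rw [this.2]; ring⟩
  have hsum := sum_eq_sum_card_mul Finset.univ
    (fun π : Equiv.Perm (Fin n) => leftPeaks π) (Finset.Icc 0 (n / 2))
    (fun π _ => Finset.mem_Icc.2 ⟨Nat.zero_le _, by have := (hstat π).1; omega⟩)
    fun k => u ^ (2 * k) * v ^ (n - 2 * k)
  have hD := iterate_zero_words D hu hv (τ := fun e => if e then v else u)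
    (by simp only [if_true, Bool.false_eq_true, if_false, hv]; ring)
    (by simp only [if_true, Bool.false_eq_true, if_false, hu]) n
  simp only [Bool.false_eq_true, if_false] at hD
  simp only [numP]
  rw [hD, ← signs_permutations, List.map_map,
    ← sum_perm_words, ← hsum, mul_assoc]
  refine congrArg _ ?_
  rw [Finset.mul_sum]
  exact Finset.sum_congr rfl fun π _ => (hstat π).2

theorem iterate_eq_sum_numR {τ : R} (h : D τ = 2 * u * τ) {n : ℕ} (hn : 1 ≤ n) :
    D^[n] (u * τ) = 2 ^ (n - 1) * τ * (u + v) *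
      ∑ k ∈ Finset.Icc 1 n, (numR (n + 1) k : R) * (u ^ k * v ^ (n - k)) := by
  obtain ⟨m, rfl⟩ := Nat.exists_eq_add_of_le' hn
  have hstat : ∀ π : Equiv.Perm (Fin (m + 1 + 1)),
      altRuns (permWord π) 1 (m + 1 + 1) ∈ Finset.Icc 1 (m + 1) ∧
      u * (signWeight u v (fun _ => τ) false (signList
          ((wordList (permWord π) 1 (m + 1 + 1)).headD 0)
          (wordList (permWord π) 1 (m + 1 + 1)).tail) +
        signWeight u v (fun _ => τ) true (signList
          ((wordList (permWord π) 1 (m + 1 + 1)).headD 0)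
          (wordList (permWord π) 1 (m + 1 + 1)).tail)) =
        τ * (u + v) * (u ^ altRuns (permWord π) 1 (m + 1 + 1) *
          v ^ (m + 1 - altRuns (permWord π) 1 (m + 1 + 1))) := fun π => by
    have hr := altRuns_eq_signChanges (permWord π) 1 m fun i _ hi => permWord_ne π (by omega)
    rw [show 1 + m + 1 = m + 1 + 1 by ring] at hr
    have hw := signWeight_const u v τ (decide (permWord π 1 < permWord π (1 + 1)))
      (signList (permWord π (1 + 1)) (wordList (permWord π) (1 + 2) m))
    rw [length_signList, length_wordList] at hw
    rw [hr, Finset.mem_Icc, Nat.add_sub_add_right, wordList_succ, wordList_succ, List.headD_cons,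
      List.tail_cons, signList]
    refine ⟨⟨by omega, by omega⟩, ?_⟩
    -- Of the two virtual preceding signs, one agrees with the first sign and the other does not,
    -- which yields the factor `u + v`.
    cases hc : decide (permWord π 1 < permWord π (1 + 1)) <;>
    · rw [hc] at hw
      simp only [signWeight, if_true, if_false, Bool.false_eq_true, Bool.true_eq_false]
      rw [hw.2]
      ring
  have hsum := sum_eq_sum_card_mul Finset.univ
    (fun π : Equiv.Perm (Fin (m + 1 + 1)) => altRuns (permWord π) 1 (m + 1 + 1))
    (Finset.Icc 1 (m + 1)) (fun π _ => (hstat π).1) fun k => u ^ k * v ^ (m + 1 - k)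
  simp only [numR]
  apply eq_of_two_mul_eq
  rw [iterate_free_words D hu hv h (m + 1), ← free_signs_permutations, List.map_map,
    ← sum_perm_words, ← hsum, Nat.add_sub_cancel, pow_succ']
  simp only [Function.comp_apply]
  rw [Finset.sum_congr rfl fun π _ => (hstat π).2, ← Finset.mul_sum]
  ring

theorem iterate_eq_sum_numT {τ : R} (h : D τ = (3 * u + v) * τ) (n : ℕ) :
    D^[n] τ = τ *
      ∑ k ∈ Finset.Icc 1 (n + 1), (numT (n + 1) k : R) * (u ^ (k - 1) * v ^ (n + 1 - k)) := by
  let S := descend (fun s => insSigns true s ++ insSigns false s) [[]] (n + 1)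
  let W : List Bool → R := fun s => signWeight u v (fun _ => τ) (s.headD true) s.tail
  -- The weight restricted to words whose first sign is an ascent, that is, to `π(1) > 0`.
  let F : List Bool → R := fun s => if s.headD true = true then W s else 0
  have hF : (S.map W).sum = 2 * (S.map F).sum := by
    have hsym : (S.map F).sum = (S.map fun s => F (s.map not)).sum := by
      have := ((descend_signed_perm (n + 1)).map F).sum_eq
      rw [List.map_map] at this
      exact this.symm
    rw [two_mul]
    nth_rw 2 [hsym]
    rw [← List.sum_map_add]
    refine congrArg List.sum (List.map_congr_left fun s hs => ?_)
    obtain ⟨r, -, hs⟩ := List.mem_flatMap.1 hs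
    obtain ⟨c, s, rfl⟩ := List.exists_cons_of_ne_nil
      ((List.mem_append.1 hs).elim (insSigns_ne_nil _ _ _) (insSigns_ne_nil _ _ _))
    cases c
    · simpa [F, W] using (signWeight_map_not u v τ false s).symm
    · simp [F, W]
  have hstat : ∀ π : SignedPerm (n + 1), signedRuns π ∈ Finset.Icc 1 (n + 1) ∧
      F (signList 0 (wordList (signedWord π) 1 (n + 1))) =
        if 0 < signedWord π 1 then
          τ * (u ^ (signedRuns π - 1) * v ^ (n + 1 - signedRuns π)) else 0 := fun π => by
    have hw := signWeight_const u v τ (decide (0 < signedWord π 1))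
      (signList (signedWord π 1) (wordList (signedWord π) 2 n))
    rw [length_signList, length_wordList] at hw
    rw [signedRuns_eq_signChanges, Finset.mem_Icc, Nat.add_sub_cancel, Nat.add_sub_add_right,
      wordList_succ, signList]
    refine ⟨⟨by omega, by omega⟩, ?_⟩
    simp only [F, W, List.headD_cons, List.tail_cons, decide_eq_true_eq]
    rw [hw.2, mul_assoc]
  have hsum := sum_eq_sum_card_mul (Finset.univ.filter fun π : SignedPerm (n + 1) =>
      0 < signedWord π 1) (fun π => signedRuns π) (Finset.Icc 1 (n + 1))
    (fun π _ => (hstat π).1) fun k => u ^ (k - 1) * v ^ (n + 1 - k)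
  simp only [Finset.filter_filter] at hsum
  simp only [numT]
  apply eq_of_two_mul_eq
  rw [iterate_signed_words D hu hv h n, ← hsum, Finset.mul_sum, Finset.sum_filter]
  change (S.map W).sum = _
  rw [hF]
  simp only [S]
  rw [← signs_signedWords, List.map_map, ← sum_signed_words]
  exact congrArg _ (Finset.sum_congr rfl fun π _ => (hstat π).2)

end Expansions

/-! ### Specialization to the grammar -/

theorem iterate_grammar_derivation {R : Type*} [CommRing R] [Algebra ℚ R] (D : Derivation ℚ R R)
    {x y z : R} (hx : D x = x * y ^ 2) (hy : D y = y * z ^ 2) (hz : z * D z = y ^ 4)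
    {n : ℕ} (hn : 1 ≤ n) :
    D^[n] (x ^ 3 * y) =
      x ^ 3 * y * ∑ k ∈ Finset.Icc 1 (n + 1),
        (numT (n + 1) k : R) * y ^ (2 * k - 2) * z ^ (2 * n + 2 - 2 * k) ∧
    D^[n] (x * y) =
      x * y * (y ^ 2 + z ^ 2) * ∑ k ∈ Finset.Icc 1 n,
        (numT n k : R) * y ^ (2 * k - 2) * z ^ (2 * n - 2 * k) ∧
    D^[n] (x ^ 2) =
      2 ^ n * x ^ 2 * ∑ k ∈ Finset.Icc 0 n,
        (numM n k : R) * y ^ (2 * k) * z ^ (2 * n - 2 * k) ∧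
    D^[n] (x ^ 2 * y ^ 2) =
      2 ^ (n - 1) * x ^ 2 * (y ^ 2 + z ^ 2) * ∑ k ∈ Finset.Icc 1 n,
        (numR (n + 1) k : R) * y ^ (2 * k) * z ^ (2 * n - 2 * k) ∧
    D^[n] (y ^ 2) =
      2 ^ n * y ^ 2 * ∑ k ∈ Finset.Icc 0 (n / 2),
        (numP n k : R) * y ^ (4 * k) * z ^ (2 * n - 4 * k) := by
  have hsq : ∀ a : R, D (a ^ 2) = 2 * (a * D a) := fun a => by
    rw [D.leibniz_pow]; simp only [smul_eq_mul, nsmul_eq_mul]; push_cast; ring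
  have hu : D (y ^ 2) = 2 * y ^ 2 * z ^ 2 := by rw [hsq, hy]; ring
  have hv : D (z ^ 2) = 2 * (y ^ 2) ^ 2 := by rw [hsq, hz]; ring
  have hx2 : D (x ^ 2) = 2 * y ^ 2 * x ^ 2 := by rw [hsq, hx]; ring
  have hxy : D (x * y) = x * y * (y ^ 2 + z ^ 2) := by
    rw [D.leibniz, hx, hy]; simp only [smul_eq_mul]; ring
  refine ⟨?_, ?_, ?_, ?_, ?_⟩
  · rw [iterate_eq_sum_numT D hu hv (τ := x ^ 3 * y)
      (by rw [D.leibniz, D.leibniz_pow, hx, hy]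
          simp only [smul_eq_mul, nsmul_eq_mul]
          push_cast
          ring) n]
    refine congrArg _ (Finset.sum_congr rfl fun k _ => ?_)
    rw [← pow_mul, ← pow_mul, Nat.mul_sub, Nat.mul_sub, mul_assoc]
    rfl
  · obtain ⟨m, rfl⟩ := Nat.exists_eq_add_of_le' hn
    -- One derivative of `x * y` is spent to reach `x * y * (y ^ 2 + z ^ 2)`, which satisfies the
    -- same rule `D τ = (3 * u + v) * τ` as `x ^ 3 * y`; hence `numT n` here instead of `numT (n +
    -- 1)`.
    rw [Function.iterate_succ_apply, hxy,
      iterate_eq_sum_numT D hu hv (τ := x * y * (y ^ 2 + z ^ 2))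
      (by rw [D.leibniz, hxy, map_add, hu, hv]
          simp only [smul_eq_mul]
          ring) m]
    refine congrArg _ (Finset.sum_congr rfl fun k _ => ?_)
    rw [← pow_mul, ← pow_mul, Nat.mul_sub, Nat.mul_sub, mul_assoc]
  · rw [iterate_eq_sum_numM D hu hv hx2 hn]
    refine congrArg _ (Finset.sum_congr rfl fun k _ => ?_)
    rw [← pow_mul, ← pow_mul, Nat.mul_sub, mul_assoc]
  · rw [mul_comm (x ^ 2) (y ^ 2), iterate_eq_sum_numR D hu hv hx2 hn]
    refine congrArg _ (Finset.sum_congr rfl fun k _ => ?_)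
    rw [← pow_mul, ← pow_mul, Nat.mul_sub, mul_assoc]
  · rw [iterate_eq_sum_numP D hu hv hn]
    refine congrArg _ (Finset.sum_congr rfl fun k _ => ?_)
    rw [← pow_mul, ← pow_mul, Nat.mul_sub, show 4 * k = 2 * (2 * k) by ring, mul_assoc]

theorem mainTheorem3
    (x y z : FormalSeries (Fin 3))
    (hx : x = letter 0) (hy : y = letter 1) (hz : z = letter 2)
    (D : Derivation ℚ (FormalSeries (Fin 3)) (FormalSeries (Fin 3)))
    (hD : D = formalDerivative ![x * y ^ 2, y * z ^ 2, y ^ 4 * letterInv 2])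
    (n : ℕ) (hn : 1 ≤ n) :
    D^[n] (x ^ 3 * y) =
      x ^ 3 * y * ∑ k ∈ Finset.Icc 1 (n + 1),
        (numT (n + 1) k : FormalSeries (Fin 3)) * y ^ (2 * k - 2) * z ^ (2 * n + 2 - 2 * k) ∧
    D^[n] (x * y) =
      x * y * (y ^ 2 + z ^ 2) * ∑ k ∈ Finset.Icc 1 n,
        (numT n k : FormalSeries (Fin 3)) * y ^ (2 * k - 2) * z ^ (2 * n - 2 * k) ∧
    D^[n] (x ^ 2) =
      2 ^ n * x ^ 2 * ∑ k ∈ Finset.Icc 0 n,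
        (numM n k : FormalSeries (Fin 3)) * y ^ (2 * k) * z ^ (2 * n - 2 * k) ∧
    D^[n] (x ^ 2 * y ^ 2) =
      2 ^ (n - 1) * x ^ 2 * (y ^ 2 + z ^ 2) * ∑ k ∈ Finset.Icc 1 n,
        (numR (n + 1) k : FormalSeries (Fin 3)) * y ^ (2 * k) * z ^ (2 * n - 2 * k) ∧
    D^[n] (y ^ 2) =
      2 ^ n * y ^ 2 * ∑ k ∈ Finset.Icc 0 (n / 2),
        (numP n k : FormalSeries (Fin 3)) * y ^ (4 * k) * z ^ (2 * n - 4 * k) := by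
  have hDl : ∀ a, D (letter a) = ![x * y ^ 2, y * z ^ 2, y ^ 4 * letterInv 2] a := by
    rw [hD]
    exact formalDerivative_letter _
  refine iterate_grammar_derivation D (x := x) (y := y) (z := z) ?_ ?_ ?_ hn
  · simpa [← hx] using hDl 0
  · simpa [← hy] using hDl 1
  · have h2 : D z = y ^ 4 * letterInv 2 := by simpa [← hz] using hDl 2
    rw [h2, mul_left_comm, hz, letter_mul_letterInv, mul_one]
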